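/- Let $(p_k)_{k\ge 0}$ be a probability distribution on $\mathbb N$ with $p_0+p_1<1$, $\sum_{k} k\,p_k<1$, and $\sum_k p_k v^k<\infty$ for all $v\ge 0$; put $R(v)=\sum_{k\ge 2}p_kv^k$. For $n\ge 0$ let $\mathcal T_n$ be the set of planar rooted trees of height at most $n+1$. The nodes of $\omega\in\mathcal T_n$ are the vertices $i$ at distance $|i|\le n$ from the root, $X_i$ is the number of offspring of $i$, $a(i)$ is the parent of $i$, and $N_n=\sum_{|i|=n}X_i$ is the number of external nodes (the vertices at distance $n+1$ from the root). For $x\in\{1,2\}$, where $X_{a(0)}=x$ by convention for the root $0$, and for $b=e^\beta>1$, let $$H_n^x(\omega)=-\sum_{i\in\omega}1_{\{X_{a(i)}\ge 2\}}1_{\{X_i\ge 2\}},\qquad \Xi_n^x=\sum_{\omega\in\mathcal T_n}e^{-\beta H_n^x(\omega)}\prod_{i\in\omega}p_{X_i},$$ $$\mathbb P_n^x(\omega)=(\Xi_n^x)^{-1}e^{-\beta H_n^x(\omega)}\prod_{i\in\omega}p_{X_i},$$ and let $\mathbb E_n^x$ be the expectation with respect to $\mathbb P_n^x$. All the series $\Xi_n^x$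 are convergent. There is a critical value $b_c=b_c((p_k)_k)>1$, characterized by the property that, for every $b>1$ and $x\in\{1,2\}$, $\Xi_n^x$ converges to a finite limit as $n\to\infty$ if and only if $b\le b_c$. For $b=b_c$ there are $u,v\ge 1$ with $$u=p_0+p_1u+R(v),\qquad v=p_0+p_1u+b_cR(v),\qquad 1=\frac{(1-p_1)b_c+p_1}{1-p_1}\,R'(v).$$ Moreover, if $b=b_c$, then for each $x\in\{1,2\}$ there is a constant $C>1$ such that for all $n\ge 1$ the expectation $\mathbb E_n^xN_n$ is finite and $$C^{-1}<n^2\,\mathbb E_n^xN_n<C .$$ -/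

import Mathlib

open Filter Topology

namespace InteractingBGW

/-- `PlaneTree n` is the set of planar rooted trees of height at most `n + 1`, in which the offspring at
distance `n + 1` from the root (the external nodes) carry no information except their number.
For `n = 0` such a tree is given by the number of offspring of the root; otherwise it is given by
the number `k` of offspring of the root and the ordered family of the `k` subtrees above them. -/
inductive PlaneTree : ℕ → Type
  | last (k : ℕ) : PlaneTree 0
  | branch {n : ℕ} (k : ℕ) (c : Fin k → PlaneTree n) : PlaneTree (n + 1)

/-- The nodes of a tree in `PlaneTree n`, external nodes excluded: those at distance at most `n` from
the root. In `branch k c` these are the root (`none`), and the nodes `i` of the subtree above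
the `j`-th offspring of the root (`some ⟨j, i⟩`). -/
def Node : {n : ℕ} → PlaneTree n → Type
  | _, .last _ => Unit
  | _, .branch k c => Option (Σ j : Fin k, Node (c j))

instance instFintypeNode : {n : ℕ} → (ω : PlaneTree n) → Fintype (Node ω)
  | _, .last _ => inferInstanceAs (Fintype Unit)
  | _, .branch k c =>
    letI : ∀ j : Fin k, Fintype (Node (c j)) := fun j => instFintypeNode (c j)
    inferInstanceAs (Fintype (Option (Σ j : Fin k, Node (c j))))

/-- The distance `|i|` of the node `i` from the root. -/
def depth : {n : ℕ} → (ω : PlaneTree n) → Node ω → ℕ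
  | _, .last _ => fun _ => 0
  | _, .branch k c => fun i =>
    match (i : Option (Σ j : Fin k, Node (c j))) with
    | none => 0
    | some ⟨j, i'⟩ => depth (c j) i' + 1

/-- The number `X_i` of offspring of the node `i`. -/
def offspring : {n : ℕ} → (ω : PlaneTree n) → Node ω → ℕ
  | _, .last k => fun _ => k
  | _, .branch k c => fun i =>
    match (i : Option (Σ j : Fin k, Node (c j))) with
    | none => k
    | some ⟨j, i'⟩ => offspring (c j) i'

/-- The number `X_{a(i)}` of offspring of the parent `a(i)` of the node `i`, where the root has a
virtual parent with `x` offspring. -/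
def parentOffspring (x : ℕ) : {n : ℕ} → (ω : PlaneTree n) → Node ω → ℕ
  | _, .last _ => fun _ => x
  | _, .branch k c => fun i =>
    match (i : Option (Σ j : Fin k, Node (c j))) with
    | none => x
    | some ⟨j, i'⟩ => parentOffspring k (c j) i'

/-- The number `N_n` of external nodes of a tree in `PlaneTree n`: the sum of the `X_i` over the nodes
`i` at distance `n` from the root. -/
def externalNodes {n : ℕ} (ω : PlaneTree n) : ℕ :=
  ∑ i : Node ω with depth ω i = n, offspring ω i

/-- The pair interaction energy `φ(X, Y) = - 1_{X ≥ 2} 1_{Y ≥ 2}`. -/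
def interaction (X Y : ℕ) : ℝ := if 2 ≤ X ∧ 2 ≤ Y then -1 else 0

/-- The Hamiltonian `H_n^x(ω) = ∑_{i ∈ ω} φ(X_{a(i)}, X_i)`. -/
def hamiltonian (x : ℕ) {n : ℕ} (ω : PlaneTree n) : ℝ :=
  ∑ i : Node ω, interaction (parentOffspring x ω i) (offspring ω i)

/-- The free Bienaymé-Galton-Watson probability of a tree. -/
def bgwProb (p : ℕ → ℝ) {n : ℕ} (ω : PlaneTree n) : ℝ :=
  ∏ i : Node ω, p (offspring ω i)

noncomputable section

/-- The unnormalized weight `P^GW(ω) exp (- β H_n^x(ω))`. -/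
def weight (p : ℕ → ℝ) (β : ℝ) (x n : ℕ) (ω : PlaneTree n) : ℝ :=
  bgwProb p ω * Real.exp (-β * hamiltonian x ω)

/-- The partition function `Ξ_n^x` at inverse temperature `β`. -/
def partitionFn (p : ℕ → ℝ) (β : ℝ) (x n : ℕ) : ℝ :=
  ∑' ω : PlaneTree n, weight p β x n ω

/-- The interacting probability `P_n^x(ω)`. -/
def gibbsProb (p : ℕ → ℝ) (β : ℝ) (x n : ℕ) (ω : PlaneTree n) : ℝ :=
  (partitionFn p β x n)⁻¹ * weight p β x n ω

/-- The expectation `E_n^x f`. -/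
def expectation (p : ℕ → ℝ) (β : ℝ) (x n : ℕ) (f : PlaneTree n → ℝ) : ℝ :=
  ∑' ω : PlaneTree n, gibbsProb p β x n ω * f ω

/-- `R(v) = ∑_{k ≥ 2} p_k v^k`. -/
def R (p : ℕ → ℝ) (v : ℝ) : ℝ := ∑' k : ℕ, p (k + 2) * v ^ (k + 2)

/-- `(u, v)` with `u, v ≥ 1` is a critical fixed point at the parameter `b`: it is a fixed point of
`F(u, v) = (p₀ + p₁ u + R(v), p₀ + p₁ u + b R(v))`, and, once `u` is eliminated, the bisector is
tangent at `v` to the graph of the resulting right-hand side. -/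
def IsCriticalPoint (p : ℕ → ℝ) (b u v : ℝ) : Prop :=
  1 ≤ u ∧ 1 ≤ v ∧
  u = p 0 + p 1 * u + R p v ∧
  v = p 0 + p 1 * u + b * R p v ∧
  1 = ((1 - p 1) * b + p 1) / (1 - p 1) * deriv (R p) v

/-- `b_c` is the critical value of `b = exp β`: it exceeds `1`, it is the parameter of a critical
fixed point, and for every `b > 1` and both boundary conditions `x = 1, 2` the partition function
(a convergent series for each `n`) has a finite limit as `n → ∞` if and only if `b ≤ b_c`. -/
def IsCriticalValue (p : ℕ → ℝ) (b_c : ℝ) : Prop :=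
  1 < b_c ∧
  (∃ u v : ℝ, IsCriticalPoint p b_c u v) ∧
  ∀ b : ℝ, 1 < b → ∀ x : ℕ, x = 1 ∨ x = 2 →
    (∀ n : ℕ, Summable (weight p (Real.log b) x n)) ∧
    ((∃ l : ℝ, Tendsto (fun n : ℕ => partitionFn p (Real.log b) x n) atTop (𝓝 l)) ↔ b ≤ b_c)

end

end InteractingBGW

/-! Splitting a tree at its root turns the partition functions into iterates of F(u, v) = (p₀ + p₁u
+ R(v), p₀ + p₁u + bR(v)): Ξ_n^x is component x of F^{n+1}(1, 1) (`hasSum_weight`), because a vertex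
influences the subtrees above it only through whether it has at least two offspring. The
unnormalized mean of N_n obeys the differentiated recursion: it is the product of the Jacobians of F
along the orbit, applied to (1, 1) (`hasSum_weight_mul_externalNodes`).

F is monotone and F(1, 1) ≥ (1, 1), so the orbit increases, and it converges exactly when it is
bounded. Eliminating u, a fixed point satisfies v - p₀/(1 - p₁) = (b + p₁/(1 - p₁)) R(v), so b_c is
read off from the maximum of (w - p₀/(1 - p₁))/R(w) over w ≥ 1. Subcriticality makes this quotient
increase at w = 1; hence the maximizer v is interior, which gives tangency, v > 1 and b_c > 1
(`exists_critical_slope`, `exists_isCriticalValue`).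

Tangency says that (p₁, 1 - p₁) is a left eigenvector of DF(u, v) for the eigenvalue 1. Paired with
the distance of the orbit to (u, v), it gives a sequence L_n whose decrement is purely the second
order term of R, hence of order L_n². So 1/L_n grows linearly, and the increments d_n of the orbit,
paired with the eigenvector, are of order n⁻² (`decrement_bounds`, `increment_bounds`).

By convexity, DF(x_n) d_n ≤ d_{n+1} ≤ DF(x_{n+1}) d_n along the orbit x_n, while the moments satisfy
m_{n+1} = DF(x_n) m_n. Moments and increments are therefore comparable up to a shift of the index
(`exists_moment_le`, `exists_increment_le`), and the normalization stays between 1 and v. -/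

namespace InteractingBGW

/-! ### Decomposition of trees at the root -/

section Branch

variable {n k : ℕ} (c : Fin k → PlaneTree n)

theorem depth_branch_none :
    depth (.branch k c) (none : Option (Σ j : Fin k, Node (c j))) = 0 := by
  rw [depth]

theorem depth_branch_some (j : Fin k) (i : Node (c j)) :
    depth (.branch k c) (some ⟨j, i⟩ : Option (Σ j : Fin k, Node (c j))) = depth (c j) i + 1 := by
  rw [depth]

theorem offspring_branch_none :
    offspring (.branch k c) (none : Option (Σ j : Fin k, Node (c j))) = k := by
  rw [offspring]

theorem offspring_branch_some (j : Fin k) (i : Node (c j)) :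
    offspring (.branch k c) (some ⟨j, i⟩ : Option (Σ j : Fin k, Node (c j))) =
      offspring (c j) i := by
  rw [offspring]

theorem parentOffspring_branch_none (x : ℕ) :
    parentOffspring x (.branch k c) (none : Option (Σ j : Fin k, Node (c j))) = x := by
  rw [parentOffspring]

theorem parentOffspring_branch_some (x : ℕ) (j : Fin k) (i : Node (c j)) :
    parentOffspring x (.branch k c) (some ⟨j, i⟩ : Option (Σ j : Fin k, Node (c j))) =
      parentOffspring k (c j) i := by
  rw [parentOffspring]

theorem bgwProb_branch (p : ℕ → ℝ) : bgwProb p (.branch k c) = p k * ∏ j, bgwProb p (c j) := by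
  refine (Fintype.prod_option fun i : Option (Σ j : Fin k, Node (c j)) =>
    p (offspring (.branch k c) i)).trans ?_
  rw [Fintype.prod_sigma, offspring_branch_none]
  simp only [offspring_branch_some, bgwProb]

theorem hamiltonian_branch (x : ℕ) :
    hamiltonian x (.branch k c) = interaction x k + ∑ j, hamiltonian k (c j) := by
  refine (Fintype.sum_option fun i : Option (Σ j : Fin k, Node (c j)) =>
    interaction (parentOffspring x (.branch k c) i) (offspring (.branch k c) i)).trans ?_
  rw [Fintype.sum_sigma, offspring_branch_none, parentOffspring_branch_none]
  simp only [offspring_branch_some, parentOffspring_branch_some, hamiltonian]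

theorem externalNodes_branch : externalNodes (.branch k c) = ∑ j, externalNodes (c j) := by
  simp only [externalNodes, Finset.sum_filter]
  refine (Fintype.sum_option fun i : Option (Σ j : Fin k, Node (c j)) =>
    if depth (.branch k c) i = n + 1 then offspring (.branch k c) i else 0).trans ?_
  rw [Fintype.sum_sigma, depth_branch_none]
  simp [depth_branch_some, offspring_branch_some]

theorem weight_branch (p : ℕ → ℝ) (β : ℝ) (x : ℕ) :
    weight p β x (n + 1) (.branch k c) =
      p k * Real.exp (-β * interaction x k) * ∏ j, weight p β k n (c j) := by
  simp only [weight]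
  rw [bgwProb_branch, hamiltonian_branch, mul_add, Real.exp_add, Finset.mul_sum, Real.exp_sum,
    Finset.prod_mul_distrib]
  ring

end Branch

theorem weight_last (p : ℕ → ℝ) (β : ℝ) (x k : ℕ) :
    weight p β x 0 (.last k) = p k * Real.exp (-β * interaction x k) := by
  have h1 : bgwProb p (.last k) = p k :=
    Fintype.prod_unique (ι := Unit) fun i => p (offspring (.last k) i)
  have h2 : hamiltonian x (.last k) = interaction x k :=
    Fintype.sum_unique (ι := Unit) fun i =>
      interaction (parentOffspring x (.last k) i) (offspring (.last k) i)
  rw [weight, h1, h2]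

theorem externalNodes_last (k : ℕ) : externalNodes (.last k) = k := by
  simp only [externalNodes, Finset.sum_filter]
  exact (Fintype.sum_unique (ι := Unit) fun i =>
    if depth (.last k) i = 0 then offspring (.last k) i else 0).trans (if_pos rfl)

theorem weight_nonneg {p : ℕ → ℝ} (hp : ∀ k, 0 ≤ p k) (β : ℝ) (x n : ℕ) (ω : PlaneTree n) :
    0 ≤ weight p β x n ω :=
  mul_nonneg (Finset.prod_nonneg fun _ _ => hp _) (Real.exp_pos _).le

/-- A tree of height at most `1` is given by the number of offspring of its root. -/
def lastEquiv : ℕ ≃ PlaneTree 0 where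
  toFun := .last
  invFun | .last k => k
  left_inv _ := rfl
  right_inv | .last _ => rfl

/-- Decomposition of a tree at its root. -/
def branchEquiv (n : ℕ) : (Σ k : ℕ, Fin k → PlaneTree n) ≃ PlaneTree (n + 1) where
  toFun c := .branch c.1 c.2
  invFun | .branch k c => ⟨k, c⟩
  left_inv _ := rfl
  right_inv | .branch _ _ => rfl

/-- The Boltzmann factor `e^{-β φ(X, Y)}` written in terms of `b = e^β`. -/
noncomputable def factor (b : ℝ) (X Y : ℕ) : ℝ := if 2 ≤ X ∧ 2 ≤ Y then b else 1

theorem exp_neg_log_mul_interaction {b : ℝ} (hb : 0 < b) (X Y : ℕ) :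
    Real.exp (-Real.log b * interaction X Y) = factor b X Y := by
  unfold interaction factor
  split_ifs <;> simp [Real.exp_log hb]

theorem hasSum_mul_of_nonneg {α β : Type*} {f : α → ℝ} {g : β → ℝ} {a b : ℝ} (hf : ∀ x, 0 ≤ f x)
    (hg : ∀ y, 0 ≤ g y) (ha : HasSum f a) (hb : HasSum g b) :
    HasSum (fun x : α × β => f x.1 * g x.2) (a * b) :=
  ha.mul hb (ha.summable.mul_of_nonneg hb.summable hf hg)

theorem hasSum_fin_prod {α : Type*} {k : ℕ} {f : Fin k → α → ℝ} {a : Fin k → ℝ}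
    (hf : ∀ j ω, 0 ≤ f j ω) (h : ∀ j, HasSum (f j) (a j)) :
    HasSum (fun c : Fin k → α => ∏ j, f j (c j)) (∏ j, a j) := by
  induction k with
  | zero =>
    simp only [Finset.univ_eq_empty, Finset.prod_empty]
    exact hasSum_unique fun _ : Fin 0 → α => (1 : ℝ)
  | succ k ih =>
    have h0 := h 0
    have ih' := ih (fun j => hf j.succ) fun j => h j.succ
    have hs := hasSum_mul_of_nonneg (hf 0)
      (fun c => Finset.prod_nonneg fun j _ => hf j.succ (c j)) h0 ih'
    rw [← (Fin.consEquiv fun _ => α).hasSum_iff, Fin.prod_univ_succ]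
    convert! hs using 2 with c
    rw [Function.comp_apply, Fin.prod_univ_succ]
    rfl

theorem hasSum_sigma_of_nonneg {α : Type*} {β : α → Type*} {f : (Σ x, β x) → ℝ} {g : α → ℝ}
    {a : ℝ} (hf : ∀ x, 0 ≤ f x) (hg : ∀ x, HasSum (fun y => f ⟨x, y⟩) (g x)) (ha : HasSum g a) :
    HasSum f a := by
  refine HasSum.sigma_of_hasSum ha hg ((summable_sigma_of_nonneg hf).2 ⟨fun x => (hg x).summable, ?_⟩)
  simpa only [(hg _).tsum_eq] using ha.summable

section Recursion

variable {p : ℕ → ℝ} {b : ℝ} {x n : ℕ}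

theorem hasSum_weight_zero (hb : 0 < b) {a : ℝ}
    (h : HasSum (fun k => p k * factor b x k) a) : HasSum (weight p (Real.log b) x 0) a := by
  rw [← lastEquiv.hasSum_iff]
  convert h using 2 with k
  rw [← exp_neg_log_mul_interaction hb]
  exact weight_last ..

theorem hasSum_weight_mul_externalNodes_zero (hb : 0 < b) {a : ℝ}
    (h : HasSum (fun k => p k * factor b x k * k) a) :
    HasSum (fun ω => weight p (Real.log b) x 0 ω * (externalNodes ω : ℝ)) a := by
  rw [← lastEquiv.hasSum_iff]
  convert h using 2 with k
  rw [← exp_neg_log_mul_interaction hb]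
  change weight _ _ _ _ (.last k) * (externalNodes (.last k) : ℝ) = _
  rw [weight_last, externalNodes_last]

/-- The value `z k` depends on `k` because the roots of the subtrees have a parent with `k`
offspring. -/
theorem hasSum_weight_succ (hp : ∀ k, 0 ≤ p k) (hb : 0 < b) {z : ℕ → ℝ} {a : ℝ}
    (hz : ∀ k, HasSum (weight p (Real.log b) k n) (z k))
    (h : HasSum (fun k => p k * factor b x k * z k ^ k) a) :
    HasSum (weight p (Real.log b) x (n + 1)) a := by
  rw [← (branchEquiv n).hasSum_iff]
  refine hasSum_sigma_of_nonneg (fun _ => weight_nonneg hp _ _ _ _) (fun k => ?_) h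
  have := (hasSum_fin_prod (fun _ : Fin k => weight_nonneg hp (Real.log b) k n)
    fun _ => hz k).mul_left (p k * factor b x k)
  rw [Finset.prod_const, Finset.card_univ, Fintype.card_fin] at this
  convert! this using 2 with c
  rw [← exp_neg_log_mul_interaction hb]
  exact weight_branch ..

/-- By linearity one index i is treated at a time: N (c i) is absorbed into the i-th factor and
`hasSum_fin_prod` applies. The truncated exponent at k = 0 is harmless because of the prefactor k.
-/
theorem hasSum_prod_mul_sum {α : Type*} {k : ℕ} {w N : α → ℝ} {z m : ℝ} (hw : ∀ ω, 0 ≤ w ω)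
    (hN : ∀ ω, 0 ≤ N ω) (hz : HasSum w z) (hm : HasSum (fun ω => w ω * N ω) m) :
    HasSum (fun c : Fin k → α => (∏ j, w (c j)) * ∑ j, N (c j)) (k * z ^ (k - 1) * m) := by
  have key : ∀ i : Fin k,
      HasSum (fun c : Fin k → α => (∏ j, w (c j)) * N (c i)) (z ^ (k - 1) * m) := by
    intro i
    have := hasSum_fin_prod (f := fun (j : Fin k) ω => if j = i then w ω * N ω else w ω)
      (a := fun j => if j = i then m else z)
      (fun j ω => by split_ifs <;> [exact mul_nonneg (hw _) (hN _); exact hw _])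
      (fun j => by split_ifs <;> assumption)
    convert this using 2 with c
    · rw [← Finset.mul_prod_erase _ _ (Finset.mem_univ i),
        ← Finset.mul_prod_erase _ (fun j => if j = i then w (c j) * N (c j) else w (c j))
          (Finset.mem_univ i), if_pos rfl, Finset.prod_congr rfl fun j hj =>
          if_neg (c := j = i) (Finset.ne_of_mem_erase hj)]
      ring
    · rw [← Finset.mul_prod_erase _ _ (Finset.mem_univ i), if_pos rfl,
        Finset.prod_congr rfl fun j hj => if_neg (c := j = i) (Finset.ne_of_mem_erase hj)]
      simp [Finset.card_erase_of_mem, mul_comm]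
  have := hasSum_sum fun i (_ : i ∈ Finset.univ) => key i
  simp only [← Finset.mul_sum] at this
  convert this using 1
  simp only [Finset.sum_const, Finset.card_univ, Fintype.card_fin, nsmul_eq_mul]
  ring

theorem hasSum_weight_mul_externalNodes_succ (hp : ∀ k, 0 ≤ p k) (hb : 0 < b) {z m : ℕ → ℝ}
    {a : ℝ} (hz : ∀ k, HasSum (weight p (Real.log b) k n) (z k))
    (hm : ∀ k, HasSum (fun ω => weight p (Real.log b) k n ω * (externalNodes ω : ℝ)) (m k))
    (h : HasSum (fun k => p k * factor b x k * (k * z k ^ (k - 1) * m k)) a) :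
    HasSum (fun ω => weight p (Real.log b) x (n + 1) ω * (externalNodes ω : ℝ)) a := by
  rw [← (branchEquiv n).hasSum_iff]
  refine hasSum_sigma_of_nonneg
    (fun _ => mul_nonneg (weight_nonneg hp _ _ _ _) (Nat.cast_nonneg _)) (fun k => ?_) h
  have := (hasSum_prod_mul_sum (k := k) (weight_nonneg hp (Real.log b) k n)
    (fun ω => Nat.cast_nonneg (externalNodes ω)) (hz k) (hm k)).mul_left (p k * factor b x k)
  convert! this using 2 with c
  rw [← exp_neg_log_mul_interaction hb]
  change weight _ _ _ _ (.branch k c) * (externalNodes (.branch k c) : ℝ) = _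
  rw [weight_branch, externalNodes_branch]
  push_cast
  ring

end Recursion

/-! ### Entire power series with nonnegative coefficients -/

/-- The coefficients of the derivative of a power series. -/
def derivCoeff (a : ℕ → ℝ) (k : ℕ) : ℝ := (k + 1) * a (k + 1)

/-- The sum of the power series with coefficients `a`. -/
noncomputable def series (a : ℕ → ℝ) (v : ℝ) : ℝ := ∑' k, a k * v ^ k

/-- The power series with coefficients `a` has nonnegative coefficients and converges everywhere. -/
structure IsEntire (a : ℕ → ℝ) : Prop where
  nonneg : ∀ k, 0 ≤ a k
  summable : ∀ v : ℝ, Summable fun k => a k * v ^ k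

namespace IsEntire

variable {a : ℕ → ℝ} (ha : IsEntire a)
include ha

theorem derivCoeff : IsEntire (derivCoeff a) where
  nonneg k := mul_nonneg (by positivity) (ha.nonneg _)
  summable v := by
    -- The factor k + 1 ≤ 2 ^ (k + 1) is absorbed by doubling the argument; |v| + 1 ≥ 1 allows
    -- raising the exponent by one.
    have h := (summable_nat_add_iff 1).2 (ha.summable (2 * (|v| + 1)))
    refine Summable.of_norm_bounded h fun k => ?_
    have h0 := ha.nonneg (k + 1)
    have h1 : ((k : ℝ) + 1) ≤ 2 ^ (k + 1) := by
      exact_mod_cast (Nat.lt_two_pow_self (n := k + 1)).le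
    have h2 : |v| ^ k ≤ (|v| + 1) ^ (k + 1) :=
      (pow_le_pow_left₀ (abs_nonneg v) (by linarith) k).trans
        (pow_le_pow_right₀ (by linarith [abs_nonneg v]) (Nat.le_succ k))
    simp only [InteractingBGW.derivCoeff]
    rw [norm_mul, norm_pow, Real.norm_eq_abs, Real.norm_eq_abs, abs_of_nonneg (by positivity),
      mul_pow]
    calc ((k : ℝ) + 1) * a (k + 1) * |v| ^ k
        ≤ 2 ^ (k + 1) * a (k + 1) * (|v| + 1) ^ (k + 1) := by gcongr
      _ = _ := by ring

theorem hasDerivAt (v : ℝ) : HasDerivAt (series a) (series (InteractingBGW.derivCoeff a) v) v := by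
  have h1 : HasDerivAt (fun w => ∑' k, a k * w ^ k) (∑' k : ℕ, a k * (k * v ^ (k - 1))) v := by
    refine hasDerivAt_tsum_of_isPreconnected (t := Metric.ball 0 (|v| + 1))
      (u := fun k : ℕ => a k * (k * (|v| + 1) ^ (k - 1))) (y₀ := v) ?_ Metric.isOpen_ball
      (convex_ball _ _).isPreconnected (fun k y _ => (hasDerivAt_pow k y).const_mul _) ?_ (by simp)
      (ha.summable v) (by simp)
    · rw [← summable_nat_add_iff 1]
      refine (ha.derivCoeff.summable (|v| + 1)).congr fun k => ?_
      simp only [InteractingBGW.derivCoeff]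
      rw [Nat.add_sub_cancel]
      push_cast
      ring
    · intro k y hy
      have hy' : |y| ≤ |v| + 1 := by simpa using (mem_ball_zero_iff.1 hy).le
      rw [norm_mul, norm_mul, norm_pow, Real.norm_eq_abs, Real.norm_eq_abs, Real.norm_eq_abs,
        abs_of_nonneg (ha.nonneg k), Nat.abs_cast]
      have := ha.nonneg k
      gcongr
  refine h1.congr_deriv ?_
  have hs : Summable fun k : ℕ => a k * (k * v ^ (k - 1)) := by
    rw [← summable_nat_add_iff 1]
    refine (ha.derivCoeff.summable v).congr fun k => ?_
    simp only [InteractingBGW.derivCoeff]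
    rw [Nat.add_sub_cancel]
    push_cast
    ring
  rw [hs.tsum_eq_zero_add]
  simp only [series, InteractingBGW.derivCoeff]
  push_cast
  simp only [zero_mul, mul_zero, zero_add]
  exact tsum_congr fun k => by ring

theorem mono {v w : ℝ} (hv : 0 ≤ v) (hvw : v ≤ w) : series a v ≤ series a w :=
  (ha.summable v).tsum_le_tsum (fun k => by have := ha.nonneg k; gcongr) (ha.summable w)

theorem continuous : Continuous (series a) :=
  continuous_iff_continuousAt.2 fun v => (ha.hasDerivAt v).continuousAt

theorem slope_bounds {v w : ℝ} (hv : 0 ≤ v) (hvw : v ≤ w) :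
    series (InteractingBGW.derivCoeff a) v * (w - v) ≤ series a w - series a v ∧
      series a w - series a v ≤ series (InteractingBGW.derivCoeff a) w * (w - v) := by
  have hd : Differentiable ℝ (series a) := fun t => (ha.hasDerivAt t).differentiableAt
  constructor
  · refine (convex_Icc v w).mul_sub_le_image_sub_of_le_deriv ha.continuous.continuousOn
      hd.differentiableOn (fun t ht => ?_) v (Set.left_mem_Icc.2 hvw) w (Set.right_mem_Icc.2 hvw) hvw
    rw [interior_Icc] at ht
    rw [(ha.hasDerivAt t).deriv]
    exact ha.derivCoeff.mono hv ht.1.le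
  · refine (convex_Icc v w).image_sub_le_mul_sub_of_deriv_le ha.continuous.continuousOn
      hd.differentiableOn (fun t ht => ?_) v (Set.left_mem_Icc.2 hvw) w (Set.right_mem_Icc.2 hvw) hvw
    rw [interior_Icc] at ht
    rw [(ha.hasDerivAt t).deriv]
    exact ha.derivCoeff.mono (hv.trans ht.1.le) ht.2.le

/-- Quadratic bounds for the distance of the sum to its tangent at the right end point. -/
theorem tangent_bounds {v w : ℝ} (hv : 0 ≤ v) (hvw : v ≤ w) :
    series (InteractingBGW.derivCoeff (InteractingBGW.derivCoeff a)) v / 2 * (w - v) ^ 2 ≤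
        series (InteractingBGW.derivCoeff a) w * (w - v) - (series a w - series a v) ∧
      series (InteractingBGW.derivCoeff a) w * (w - v) - (series a w - series a v) ≤
        series (InteractingBGW.derivCoeff (InteractingBGW.derivCoeff a)) w / 2 * (w - v) ^ 2 := by
  set a' := InteractingBGW.derivCoeff a with ha'
  set a'' := InteractingBGW.derivCoeff a' with ha''
  -- This function of t vanishes at t = w and has derivative s (w - t) - (a'(w) - a'(t)), whose sign
  -- on [v, w] is known from `slope_bounds` for a' when s = a''(v) or s = a''(w).
  have hd : ∀ s t : ℝ, HasDerivAt (fun t => series a' w * (w - t) - (series a w - series a t) -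
      s / 2 * (w - t) ^ 2) (series a t - series a t - (series a' w - series a' t) + s * (w - t)) t := by
    intro s t
    have h1 : HasDerivAt (fun t : ℝ => w - t) (-1) t := by
      simpa using (hasDerivAt_id t).const_sub w
    have := ((h1.const_mul (series a' w)).sub ((ha.hasDerivAt t).const_sub (series a w))).sub
      ((h1.pow 2).const_mul (s / 2))
    convert! this using 1
    push_cast
    ring
  have hcont : ∀ s, Continuous fun t => series a' w * (w - t) - (series a w - series a t) -
      s / 2 * (w - t) ^ 2 :=
    fun s => continuous_iff_continuousAt.2 fun t => (hd s t).continuousAt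
  constructor
  · have := antitoneOn_of_deriv_nonpos (convex_Icc v w) (hcont (series a'' v)).continuousOn
      (fun t _ => (hd (series a'' v) t).differentiableAt.differentiableWithinAt) (fun t ht => by
        rw [interior_Icc] at ht
        rw [(hd _ t).deriv]
        have h1 := (ha.derivCoeff.slope_bounds (hv.trans ht.1.le) ht.2.le).1
        have h2 := mul_le_mul_of_nonneg_right (ha.derivCoeff.derivCoeff.mono hv ht.1.le)
          (sub_nonneg.2 ht.2.le)
        linarith) (Set.left_mem_Icc.2 hvw) (Set.right_mem_Icc.2 hvw) hvw
    simp only [sub_self] at this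
    linarith
  · have := monotoneOn_of_deriv_nonneg (convex_Icc v w) (hcont (series a'' w)).continuousOn
      (fun t _ => (hd (series a'' w) t).differentiableAt.differentiableWithinAt) (fun t ht => by
        rw [interior_Icc] at ht
        rw [(hd _ t).deriv]
        have h1 := (ha.derivCoeff.slope_bounds (hv.trans ht.1.le) ht.2.le).2
        linarith) (Set.left_mem_Icc.2 hvw) (Set.right_mem_Icc.2 hvw) hvw
    simp only [sub_self] at this
    linarith

end IsEntire

theorem IsEntire.le_series {a : ℕ → ℝ} (ha : IsEntire a) (k : ℕ) {v : ℝ} (hv : 0 ≤ v) :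
    a k * v ^ k ≤ series a v :=
  (ha.summable v).le_tsum k fun j _ => mul_nonneg (ha.nonneg j) (pow_nonneg hv j)

/-! ### The offspring law and the function R -/

/-- The coefficients of `R`. -/
def tailCoeff (p : ℕ → ℝ) (k : ℕ) : ℝ := if k < 2 then 0 else p k

/-- The derivative of `R`. -/
noncomputable def R' (p : ℕ → ℝ) : ℝ → ℝ := series (derivCoeff (tailCoeff p))

/-- The second derivative of `R`. -/
noncomputable def R'' (p : ℕ → ℝ) : ℝ → ℝ := series (derivCoeff (derivCoeff (tailCoeff p)))

/-- The hypotheses on the offspring distribution. -/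
structure IsOffspring (p : ℕ → ℝ) : Prop where
  nonneg : ∀ k, 0 ≤ p k
  hasSum : HasSum p 1
  branch : p 0 + p 1 < 1
  entire : ∀ v : ℝ, Summable fun k : ℕ => p k * v ^ k
  subcritical : ∑' k : ℕ, (k : ℝ) * p k < 1

namespace IsOffspring

variable {p : ℕ → ℝ} (hp : IsOffspring p)
include hp

theorem isEntire_tail : IsEntire (tailCoeff p) where
  nonneg k := by
    unfold tailCoeff
    split_ifs <;> [rfl; exact hp.nonneg k]
  summable v := by
    rw [← summable_nat_add_iff 2]
    exact ((summable_nat_add_iff 2).2 (hp.entire v)).congr fun k => by simp [tailCoeff]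

theorem R_eq : R p = series (tailCoeff p) := by
  funext v
  rw [series, ← (hp.isEntire_tail.summable v).sum_add_tsum_nat_add 2]
  simp [R, tailCoeff, Finset.sum_range_succ]

theorem hasSum_R (v : ℝ) : HasSum (fun k => p (k + 2) * v ^ (k + 2)) (R p v) :=
  ((summable_nat_add_iff 2).2 (hp.entire v)).hasSum

theorem hasSum_R' (v : ℝ) :
    HasSum (fun k : ℕ => p (k + 2) * ((k + 2 : ℕ) * v ^ (k + 1))) (R' p v) := by
  have h : HasSum (fun k => derivCoeff (tailCoeff p) k * v ^ k) (R' p v) :=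
    (hp.isEntire_tail.derivCoeff.summable v).hasSum
  rw [← hasSum_nat_add_iff' 1] at h
  convert! h using 1
  · funext k
    simp [derivCoeff, tailCoeff]
    ring
  · simp [derivCoeff, tailCoeff]

theorem hasDerivAt_R (v : ℝ) : HasDerivAt (R p) (R' p v) v :=
  hp.R_eq ▸ hp.isEntire_tail.hasDerivAt v

theorem R_mono {v w : ℝ} (hv : 0 ≤ v) (hvw : v ≤ w) : R p v ≤ R p w := by
  rw [hp.R_eq]
  exact hp.isEntire_tail.mono hv hvw

theorem R'_mono {v w : ℝ} (hv : 0 ≤ v) (hvw : v ≤ w) : R' p v ≤ R' p w :=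
  hp.isEntire_tail.derivCoeff.mono hv hvw

theorem R''_mono {v w : ℝ} (hv : 0 ≤ v) (hvw : v ≤ w) : R'' p v ≤ R'' p w :=
  hp.isEntire_tail.derivCoeff.derivCoeff.mono hv hvw

theorem R_slope_bounds {v w : ℝ} (hv : 0 ≤ v) (hvw : v ≤ w) :
    R' p v * (w - v) ≤ R p w - R p v ∧ R p w - R p v ≤ R' p w * (w - v) := by
  rw [hp.R_eq]
  exact hp.isEntire_tail.slope_bounds hv hvw

theorem R_tangent_bounds {v w : ℝ} (hv : 0 ≤ v) (hvw : v ≤ w) :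
    R'' p v / 2 * (w - v) ^ 2 ≤ R' p w * (w - v) - (R p w - R p v) ∧
      R' p w * (w - v) - (R p w - R p v) ≤ R'' p w / 2 * (w - v) ^ 2 := by
  rw [hp.R_eq]
  exact hp.isEntire_tail.tangent_bounds hv hvw

theorem total : p 0 + p 1 + R p 1 = 1 := by
  have h := (hasSum_nat_add_iff' 2).2 hp.hasSum
  have h2 := hp.hasSum_R 1
  simp only [one_pow, mul_one] at h2
  rw [h2.unique h]
  simp [Finset.sum_range_succ]

theorem R_one_pos : 0 < R p 1 := by linarith [hp.total, hp.branch]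

theorem R_pos {v : ℝ} (hv : 1 ≤ v) : 0 < R p v :=
  hp.R_one_pos.trans_le (hp.R_mono zero_le_one hv)

theorem one_sub_pos : 0 < 1 - p 1 := by linarith [hp.nonneg 0, hp.branch]

theorem exists_pos : ∃ k, 0 < p (k + 2) := by
  by_contra! h
  have h0 : R p 1 ≤ 0 := tsum_nonpos fun k => by simpa using h k
  exact h0.not_gt hp.R_one_pos

theorem R'_one_pos : 0 < R' p 1 := by
  obtain ⟨k, hk⟩ := hp.exists_pos
  refine lt_of_lt_of_le ?_ (hp.isEntire_tail.derivCoeff.le_series (k + 1) zero_le_one)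
  simp only [derivCoeff, tailCoeff]
  rw [if_neg (by omega)]
  positivity

theorem R''_one_pos : 0 < R'' p 1 := by
  obtain ⟨k, hk⟩ := hp.exists_pos
  refine lt_of_lt_of_le ?_ (hp.isEntire_tail.derivCoeff.derivCoeff.le_series k zero_le_one)
  simp only [derivCoeff, tailCoeff]
  rw [if_neg (by omega)]
  positivity

/-- The left-hand side is the mean of the offspring law. -/
theorem R'_one_lt : p 1 + R' p 1 < 1 := by
  have h := hp.hasSum_R' 1
  have h2 : HasSum (fun k : ℕ => (k : ℝ) * p k) (R' p 1 + ∑ i ∈ Finset.range 2, (i : ℝ) * p i) := by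
    rw [← hasSum_nat_add_iff 2]
    convert! h using 2 with k
    simp [mul_comm]
  have := hp.subcritical
  rw [h2.tsum_eq] at this
  simp [Finset.sum_range_succ] at this
  linarith

/-- All exponents in R are at least 2. This quadratic growth confines the maximizer in
`exists_critical_slope` and bounds the orbit in `exists_bound_of_tendsto`. -/
theorem sq_mul_R_one_le {v : ℝ} (hv : 1 ≤ v) : R p 1 * v ^ 2 ≤ R p v := by
  have h := (hp.hasSum_R 1).mul_right (v ^ 2)
  refine hasSum_le (fun k => ?_) h (hp.hasSum_R v)
  have := hp.nonneg (k + 2)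
  rw [one_pow, mul_one]
  exact mul_le_mul_of_nonneg_left (pow_le_pow_right₀ hv (by omega)) this

end IsOffspring

/-! ### Partition functions and moments as iterates -/

/-- The orbit of `(1, 1)` under `F`, with components indexed by the boundary condition. -/
noncomputable def orbit (p : ℕ → ℝ) (b : ℝ) : ℕ → ℕ → ℝ
  | 0, _ => 1
  | n + 1, x => p 0 + p 1 * orbit p b n 1 + (if 2 ≤ x then b else 1) * R p (orbit p b n 2)

/-- The product of the derivatives of `F` along the orbit of `(1, 1)`, applied to `(1, 1)`. -/
noncomputable def moment (p : ℕ → ℝ) (b : ℝ) : ℕ → ℕ → ℝ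
  | 0, _ => 1
  | n + 1, x => p 1 * moment p b n 1 +
      (if 2 ≤ x then b else 1) * (R' p (orbit p b n 2) * moment p b n 2)

/-- All k ≥ 2 thus contribute the same base to the sum over the offspring number of the root, which
is what makes R appear. -/
theorem orbit_add_two (p : ℕ → ℝ) (b : ℝ) (n k : ℕ) : orbit p b n (k + 2) = orbit p b n 2 := by
  cases n <;> simp [orbit]

theorem moment_add_two (p : ℕ → ℝ) (b : ℝ) (n k : ℕ) : moment p b n (k + 2) = moment p b n 2 := by
  cases n <;> simp [moment]

theorem factor_of_lt (b : ℝ) (x : ℕ) {k : ℕ} (hk : k < 2) : factor b x k = 1 :=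
  if_neg fun h => hk.not_ge h.2

theorem factor_add_two (b : ℝ) (x k : ℕ) : factor b x (k + 2) = if 2 ≤ x then b else 1 := by
  simp [factor]

namespace IsOffspring

variable {p : ℕ → ℝ} (hp : IsOffspring p)
include hp

theorem hasSum_orbit (b : ℝ) (x n : ℕ) :
    HasSum (fun k => p k * factor b x k * orbit p b n k ^ k) (orbit p b (n + 1) x) := by
  rw [← hasSum_nat_add_iff' 2]
  convert! (hp.hasSum_R (orbit p b n 2)).mul_left (if 2 ≤ x then b else 1) using 1
  · funext k
    rw [factor_add_two, orbit_add_two]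
    ring
  · simp [Finset.sum_range_succ, factor_of_lt, orbit]

theorem hasSum_moment (b : ℝ) (x n : ℕ) :
    HasSum (fun k : ℕ => p k * factor b x k * (k * orbit p b n k ^ (k - 1) * moment p b n k))
      (moment p b (n + 1) x) := by
  rw [← hasSum_nat_add_iff' 2]
  convert! ((hp.hasSum_R' (orbit p b n 2)).mul_right (moment p b n 2)).mul_left
    (if 2 ≤ x then b else 1) using 1
  · funext k
    rw [factor_add_two, orbit_add_two, moment_add_two, show k + 2 - 1 = k + 1 by omega]
    ring
  · simp [Finset.sum_range_succ, factor_of_lt, moment]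

theorem hasSum_weight {b : ℝ} (hb : 0 < b) (n x : ℕ) :
    HasSum (weight p (Real.log b) x n) (orbit p b (n + 1) x) := by
  induction n generalizing x with
  | zero =>
    refine hasSum_weight_zero hb ?_
    simpa [orbit] using hp.hasSum_orbit b x 0
  | succ n ih => exact hasSum_weight_succ hp.nonneg hb ih (hp.hasSum_orbit b x (n + 1))

theorem hasSum_weight_mul_externalNodes {b : ℝ} (hb : 0 < b) (n x : ℕ) :
    HasSum (fun ω => weight p (Real.log b) x n ω * (externalNodes ω : ℝ))
      (moment p b (n + 1) x) := by
  induction n generalizing x with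
  | zero =>
    refine hasSum_weight_mul_externalNodes_zero hb ?_
    have h := hp.hasSum_moment b x 0
    simpa only [orbit, moment, one_pow, mul_one] using h
  | succ n ih =>
    exact hasSum_weight_mul_externalNodes_succ hp.nonneg hb (hp.hasSum_weight hb n) ih
      (hp.hasSum_moment b x (n + 1))

theorem partitionFn_eq {b : ℝ} (hb : 0 < b) (n x : ℕ) :
    partitionFn p (Real.log b) x n = orbit p b (n + 1) x :=
  (hp.hasSum_weight hb n x).tsum_eq

theorem hasSum_gibbsProb_mul_externalNodes {b : ℝ} (hb : 0 < b) (n x : ℕ) :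
    HasSum (fun ω => gibbsProb p (Real.log b) x n ω * (externalNodes ω : ℝ))
      ((orbit p b (n + 1) x)⁻¹ * moment p b (n + 1) x) := by
  simp only [gibbsProb, mul_assoc, hp.partitionFn_eq hb]
  exact (hp.hasSum_weight_mul_externalNodes hb n x).mul_left _

end IsOffspring

/-! ### Monotonicity of the orbit and the critical value -/

namespace IsOffspring

variable {p : ℕ → ℝ} (hp : IsOffspring p)
include hp

theorem one_le_orbit {b : ℝ} (hb : 1 ≤ b) (n x : ℕ) : 1 ≤ orbit p b n x := by
  induction n generalizing x with
  | zero => exact le_rfl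
  | succ n ih =>
    have h1 : p 1 * 1 ≤ p 1 * orbit p b n 1 := mul_le_mul_of_nonneg_left (ih 1) (hp.nonneg 1)
    have h2 : R p 1 ≤ R p (orbit p b n 2) := hp.R_mono zero_le_one (ih 2)
    have h3 : 1 * R p (orbit p b n 2) ≤ (if 2 ≤ x then b else 1) * R p (orbit p b n 2) :=
      mul_le_mul_of_nonneg_right (by split_ifs <;> linarith) (hp.R_pos (ih 2)).le
    rw [orbit]
    linarith [hp.total]

theorem orbit_le_succ {b : ℝ} (hb : 1 ≤ b) (n x : ℕ) : orbit p b n x ≤ orbit p b (n + 1) x := by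
  induction n generalizing x with
  | zero => exact hp.one_le_orbit hb 1 x
  | succ n ih =>
    have h1 : p 1 * orbit p b n 1 ≤ p 1 * orbit p b (n + 1) 1 :=
      mul_le_mul_of_nonneg_left (ih 1) (hp.nonneg 1)
    have h2 := hp.R_mono (zero_le_one.trans (hp.one_le_orbit hb n 2)) (ih 2)
    have h3 := mul_le_mul_of_nonneg_left h2 (a := if 2 ≤ x then b else 1) (by split_ifs <;> linarith)
    rw [orbit, orbit]
    linarith

theorem orbit_one_le_orbit_two {b : ℝ} (hb : 1 ≤ b) (n : ℕ) : orbit p b n 1 ≤ orbit p b n 2 := by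
  cases n with
  | zero => exact le_rfl
  | succ n =>
    have := mul_le_mul_of_nonneg_right hb (hp.R_pos (hp.one_le_orbit hb n 2)).le
    simp only [orbit]
    norm_num
    linarith

theorem monotone_orbit {b : ℝ} (hb : 1 ≤ b) (x : ℕ) : Monotone fun n => orbit p b n x :=
  monotone_nat_of_le_succ fun n => hp.orbit_le_succ hb n x

/-- A supersolution of the fixed point equation bounds the orbit. -/
theorem orbit_le {b u v : ℝ} (hb : 1 ≤ b) (hu1 : 1 ≤ u) (hv1 : 1 ≤ v)
    (hu : p 0 + p 1 * u + R p v ≤ u) (hv : p 0 + p 1 * u + b * R p v ≤ v) (n : ℕ) :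
    orbit p b n 1 ≤ u ∧ orbit p b n 2 ≤ v := by
  induction n with
  | zero => exact ⟨hu1, hv1⟩
  | succ n ih =>
    have h1 := mul_le_mul_of_nonneg_left ih.1 (hp.nonneg 1)
    have h2 := hp.R_mono (zero_le_one.trans (hp.one_le_orbit hb n 2)) ih.2
    have h3 := mul_le_mul_of_nonneg_left h2 (zero_le_one.trans hb)
    constructor <;> simp only [orbit] <;> norm_num <;> linarith

theorem continuous_R : Continuous (R p) :=
  continuous_iff_continuousAt.2 fun v => (hp.hasDerivAt_R v).continuousAt

/-- A bound on the component `2` of the orbit yields a fixed point. -/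
theorem exists_fixedPoint_of_bounded {b B : ℝ} (hb : 1 ≤ b) (hB : ∀ n, orbit p b n 2 ≤ B) :
    ∃ u v : ℝ, 1 ≤ v ∧ u = p 0 + p 1 * u + R p v ∧ v = p 0 + p 1 * u + b * R p v := by
  have hV := tendsto_atTop_ciSup (hp.monotone_orbit hb 2) ⟨B, by rintro _ ⟨n, rfl⟩; exact hB n⟩
  have hU := tendsto_atTop_ciSup (hp.monotone_orbit hb 1)
    ⟨B, by rintro _ ⟨n, rfl⟩; exact (hp.orbit_one_le_orbit_two hb n).trans (hB n)⟩
  set u := ⨆ n, orbit p b n 1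
  set v := ⨆ n, orbit p b n 2
  have hR := (hp.continuous_R.tendsto v).comp hV
  refine ⟨u, v, ge_of_tendsto' hV fun n => hp.one_le_orbit hb n 2, ?_, ?_⟩
  · refine tendsto_nhds_unique (hU.comp (tendsto_add_atTop_nat 1)) ?_
    refine ((tendsto_const_nhds.add (hU.const_mul (p 1))).add hR).congr fun n => ?_
    simp [orbit]
  · refine tendsto_nhds_unique (hV.comp (tendsto_add_atTop_nat 1)) ?_
    refine ((tendsto_const_nhds.add (hU.const_mul (p 1))).add (hR.const_mul b)).congr fun n => ?_
    simp [orbit]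

/-- A bound on either component of the orbit yields a bound on the component `2`. -/
theorem exists_bound_of_tendsto {b l : ℝ} (hb : 1 ≤ b) {x : ℕ}
    (h : Tendsto (fun n => orbit p b (n + 1) x) atTop (𝓝 l)) : ∃ B, ∀ n, orbit p b n 2 ≤ B := by
  have hl : ∀ n, orbit p b (n + 1) x ≤ l := fun n =>
    ((hp.monotone_orbit hb x).comp fun i j hij => Nat.succ_le_succ hij).ge_of_tendsto h n
  refine ⟨l / R p 1, fun n => ?_⟩
  rw [le_div_iff₀ hp.R_one_pos]
  have h1 := hp.one_le_orbit hb n 2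
  have h2 := hp.sq_mul_R_one_le h1
  have h3 : 1 * R p (orbit p b n 2) ≤ (if 2 ≤ x then b else 1) * R p (orbit p b n 2) :=
    mul_le_mul_of_nonneg_right (by split_ifs <;> linarith) (hp.R_pos h1).le
  have h4 := mul_nonneg (hp.nonneg 1) (zero_le_one.trans (hp.one_le_orbit hb n 1))
  have h5 := hl n
  rw [orbit] at h5
  have h6 : orbit p b n 2 * R p 1 ≤ R p 1 * orbit p b n 2 ^ 2 := by
    nlinarith [mul_nonneg hp.R_one_pos.le (mul_nonneg (zero_le_one.trans h1) (sub_nonneg.2 h1))]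
  linarith [hp.nonneg 0]

/-- The maximum `s` of `w ↦ (w - p₀ / (1 - p₁)) / R(w)` on `[1, ∞)` is attained at some `v > 1`. -/
theorem exists_critical_slope : ∃ s v : ℝ, 1 / (1 - p 1) < s ∧ 1 < v ∧
    (∀ w, 1 ≤ w → w - p 0 / (1 - p 1) ≤ s * R p w) ∧ v - p 0 / (1 - p 1) = s * R p v ∧
    s * R' p v = 1 := by
  set α := p 0 / (1 - p 1) with hα
  have h1p := hp.one_sub_pos
  have hα0 : 0 ≤ α := div_nonneg (hp.nonneg 0) h1p.le
  have hR1 := hp.R_one_pos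
  set g : ℝ → ℝ := fun w => (w - α) / R p w with hg
  have hg1 : g 1 = 1 / (1 - p 1) := by
    simp only [hg, hα]
    have := hp.total
    field_simp
    linarith
  have hcont : ContinuousOn g (Set.Ici 1) :=
    (continuousOn_id.sub continuousOn_const).div hp.continuous_R.continuousOn
      fun w hw => (hp.R_pos hw).ne'
  obtain ⟨v, hv1, hv⟩ : ∃ v ∈ Set.Ici (1 : ℝ), ∀ w ∈ Set.Ici (1 : ℝ), g w ≤ g v := by
    -- For w ≥ (1 - p₁)/R(1), quadratic growth gives g(w) ≤ 1/(R(1) w) ≤ 1/(1 - p₁) = g(1), so the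
    -- maximum may be sought on [1, K].
    set K := max 1 ((1 - p 1) / R p 1) with hK
    obtain ⟨v, hvm, hv⟩ := isCompact_Icc.exists_isMaxOn (Set.nonempty_Icc.2 (le_max_left 1 _ : 1 ≤ K))
      (hcont.mono Set.Icc_subset_Ici_self)
    refine ⟨v, hvm.1, fun w hw => ?_⟩
    by_cases hwK : w ≤ K
    · exact hv ⟨hw, hwK⟩
    · refine le_trans ?_ (hv (Set.left_mem_Icc.2 (le_max_left 1 _)))
      rw [hg1, hg]
      have hw1 : (1 : ℝ) ≤ w := hw
      have hw2 : (1 - p 1) / R p 1 ≤ w := (le_max_right _ _).trans (not_le.1 hwK).le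
      rw [div_le_iff₀ hR1] at hw2
      rw [div_le_div_iff₀ (hp.R_pos hw1) h1p]
      have := hp.sq_mul_R_one_le hw1
      nlinarith [mul_nonneg (sub_nonneg.2 hw2) (zero_le_one.trans hw1), mul_nonneg hα0 h1p.le]
  have hmax : ∀ w, 1 ≤ w → w - α ≤ g v * R p w := fun w hw => by
    rw [← div_le_iff₀ (hp.R_pos hw)]
    exact hv w hw
  have hveq : v - α = g v * R p v := (div_mul_cancel₀ _ (hp.R_pos hv1).ne').symm
  have hgt : 1 / (1 - p 1) < g v := by
    -- If g(1) were the maximum, g(v) R(w) - (w - α) would be minimal on [1, ∞) at the end point 1,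
    -- with nonnegative derivative there, against `R'_one_lt`.
    refine lt_of_le_of_ne (hg1 ▸ hv 1 Set.self_mem_Ici) fun heq => ?_
    have hd : HasDerivAt (fun w => g v * R p w - (w - α)) (g v * R' p 1 - 1) 1 :=
      ((hp.hasDerivAt_R 1).const_mul _).sub ((hasDerivAt_id 1).sub_const α)
    have hneg : g v * R' p 1 - 1 < 0 := by
      rw [← heq, sub_neg, one_div, inv_mul_lt_iff₀ h1p]
      linarith [hp.R'_one_lt]
    have h0 : g v * R p 1 - (1 - α) = 0 := by
      rw [← heq, ← hg1, hg]
      simp only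
      rw [div_mul_cancel₀ _ hR1.ne', sub_self]
    have hmin : IsLocalMinOn (fun w => g v * R p w - (w - α)) (Set.Ici 1) 1 := by
      filter_upwards [self_mem_nhdsWithin] with w hw
      rw [h0]
      linarith [hmax w hw]
    have := hmin.hasFDerivWithinAt_nonneg hd.hasFDerivAt.hasFDerivWithinAt
      (y := (1 : ℝ)) (mem_posTangentConeAt_of_segment_subset
        (by rw [segment_eq_Icc (by norm_num)]; exact Set.Icc_subset_Ici_self))
    simp at this
    linarith
  have hv1' : 1 < v := lt_of_le_of_ne hv1 fun h => by
    rw [← h, hg1] at hgt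
    exact lt_irrefl _ hgt
  refine ⟨g v, v, hgt, hv1', hmax, hveq, ?_⟩
  have hd : HasDerivAt (fun w => g v * R p w - (w - α)) (g v * R' p v - 1) v :=
    ((hp.hasDerivAt_R v).const_mul _).sub ((hasDerivAt_id v).sub_const α)
  have hmin : IsLocalMin (fun w => g v * R p w - (w - α)) v := by
    filter_upwards [Ici_mem_nhds hv1'] with w hw
    linarith [hmax w hw]
  linarith [hmin.hasDerivAt_eq_zero hd]

/-- Existence of the critical value, with a nontrivial critical fixed point. -/
theorem exists_isCriticalValue : ∃ b u v : ℝ, IsCriticalValue p b ∧ IsCriticalPoint p b u v ∧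
    1 < v ∧ u ≤ v := by
  obtain ⟨s, v, hs, hv1, hmax, hveq, hsR⟩ := hp.exists_critical_slope
  have h1p := hp.one_sub_pos
  have hp0 := hp.nonneg 0
  have hp1 := hp.nonneg 1
  have hne := h1p.ne'
  -- After elimination of u the slope in front of R is b + p₁/(1 - p₁), which has to equal s.
  set b := s - p 1 / (1 - p 1) with hb
  set u := (p 0 + R p v) / (1 - p 1) with hu
  have hRv := hp.R_mono zero_le_one hv1.le
  have hueq : u = p 0 + p 1 * u + R p v := by
    rw [hu]
    field_simp
    ring
  have hu1 : 1 ≤ u := by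
    rw [hu, le_div_iff₀ h1p]
    linarith [hp.total]
  have hb1 : 1 < b := by
    have : 1 / (1 - p 1) - p 1 / (1 - p 1) = 1 := by rw [← sub_div, div_self hne]
    linarith
  have hveq' : v = p 0 + p 1 * u + b * R p v := by
    have : p 0 + p 1 * u + b * R p v = p 0 / (1 - p 1) + s * R p v := by
      rw [hu, hb]
      field_simp
      ring
    linarith
  have huv : u ≤ v := by
    have := mul_le_mul_of_nonneg_right hb1.le (hp.R_pos hv1.le).le
    linarith
  have hcp : IsCriticalPoint p b u v := by
    refine ⟨hu1, hv1.le, hueq, hveq', ?_⟩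
    have : ((1 - p 1) * b + p 1) / (1 - p 1) = s := by
      rw [hb]
      field_simp
      ring
    rw [(hp.hasDerivAt_R v).deriv, this, hsR]
  refine ⟨b, u, v, ⟨hb1, ⟨u, v, hcp⟩, fun b' hb' x hx => ⟨fun n =>
    (hp.hasSum_weight (by linarith) n x).summable, ?_⟩⟩, hcp, hv1, huv⟩
  simp only [hp.partitionFn_eq (zero_lt_one.trans hb')]
  constructor
  -- A limit yields a fixed point at b', and maximality of s at its second component gives b' +
  -- p₁/(1 - p₁) ≤ s.
  · rintro ⟨l, hl⟩
    obtain ⟨B, hB⟩ := hp.exists_bound_of_tendsto hb'.le hl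
    obtain ⟨u', v', hv', hu'eq, hv'eq⟩ := hp.exists_fixedPoint_of_bounded hb'.le hB
    have h := hmax v' hv'
    have hR := hp.R_pos hv'
    have : v' - p 0 / (1 - p 1) = (b' + p 1 / (1 - p 1)) * R p v' := by
      have h1 : u' = (p 0 + R p v') / (1 - p 1) := by
        rw [eq_div_iff hne]
        linarith
      rw [h1] at hv'eq
      rw [sub_eq_iff_eq_add]
      refine hv'eq.trans ?_
      field_simp
      ring
    rw [this] at h
    have := le_of_mul_le_mul_right h hR
    linarith
  -- For b' ≤ b the critical fixed point of b is a supersolution at b'.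
  · intro hle
    have hbd := hp.orbit_le hb'.le hu1 hv1.le hueq.ge
      (by have := mul_le_mul_of_nonneg_right hle (hp.R_pos hv1.le).le; linarith)
    refine ⟨_, tendsto_atTop_ciSup ((hp.monotone_orbit hb'.le x).comp
      fun i j hij => Nat.succ_le_succ hij) ⟨v, ?_⟩⟩
    rintro _ ⟨n, rfl⟩
    rcases hx with rfl | rfl
    · exact (hbd _).1.trans huv
    · exact (hbd _).2

end IsOffspring

/-! ### Quadratic decay at the critical point -/

/-- A positive sequence whose decrements are comparable to its square has decrements comparable
to `n⁻²`. -/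
theorem decrement_bounds {L : ℕ → ℝ} {c₁ c₂ δ : ℝ} (hL : ∀ n, 0 < L n) (hc₁ : 0 < c₁) (hc₂ : 0 < c₂)
    (hδ : 0 < δ) (h₁ : ∀ n, c₁ * L n ^ 2 ≤ L n - L (n + 1))
    (h₂ : ∀ n, L n - L (n + 1) ≤ c₂ * L n ^ 2) (h₃ : ∀ n, δ * L n ≤ L (n + 1)) :
    ∃ A B : ℝ, 0 < A ∧ 0 < B ∧ ∀ n : ℕ,
      A ≤ ((n : ℝ) + 1) ^ 2 * (L n - L (n + 1)) ∧ ((n : ℝ) + 1) ^ 2 * (L n - L (n + 1)) ≤ B := by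
  -- Reciprocals linearize the recursion. The lower bound uses L (n + 1) ≤ L n in the denominator,
  -- the upper one uses `h₃`.
  have hstep : ∀ n, (L n)⁻¹ + c₁ ≤ (L (n + 1))⁻¹ ∧ (L (n + 1))⁻¹ ≤ (L n)⁻¹ + c₂ / δ := by
    intro n
    have h0 := hL n
    have h1 := hL (n + 1)
    have e : (L (n + 1))⁻¹ - (L n)⁻¹ = (L n - L (n + 1)) / (L n * L (n + 1)) := by
      field_simp
    have hlt : L (n + 1) ≤ L n := by nlinarith [h₁ n, sq_nonneg (L n)]
    constructor
    · suffices c₁ ≤ (L n - L (n + 1)) / (L n * L (n + 1)) by linarith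
      rw [le_div_iff₀ (mul_pos h0 h1)]
      nlinarith [h₁ n, mul_nonneg (mul_nonneg hc₁.le h0.le) (sub_nonneg.2 hlt)]
    · suffices (L n - L (n + 1)) / (L n * L (n + 1)) ≤ c₂ / δ by linarith
      rw [div_le_div_iff₀ (mul_pos h0 h1) hδ]
      nlinarith [mul_le_mul_of_nonneg_right (h₂ n) hδ.le,
        mul_nonneg (mul_nonneg hc₂.le h0.le) (sub_nonneg.2 (h₃ n))]
  -- Including (L 0)⁻¹ makes the linear bounds hold already at n = 0.
  set k := min c₁ (L 0)⁻¹ with hk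
  set K := max (c₂ / δ) (L 0)⁻¹ with hK
  have hk0 : 0 < k := lt_min hc₁ (inv_pos.2 (hL 0))
  have hK0 : 0 < K := lt_max_of_lt_right (inv_pos.2 (hL 0))
  have hlin : ∀ n : ℕ, k * ((n : ℝ) + 1) ≤ (L n)⁻¹ ∧ (L n)⁻¹ ≤ K * ((n : ℝ) + 1) := by
    intro n
    induction n with
    | zero => simp [hk, hK]
    | succ n ih =>
      have h1 : k ≤ c₁ := min_le_left _ _
      have h2 : c₂ / δ ≤ K := le_max_left _ _
      push_cast
      constructor <;> linarith [hstep n]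
  have hmul : ∀ n : ℕ, K⁻¹ ≤ ((n : ℝ) + 1) * L n ∧ ((n : ℝ) + 1) * L n ≤ k⁻¹ := by
    intro n
    have h0 := hL n
    obtain ⟨h1, h2⟩ := hlin n
    constructor
    · rw [inv_le_iff_one_le_mul₀ hK0]
      rw [inv_le_iff_one_le_mul₀ h0] at h2
      linarith
    · rw [← one_div, le_div_iff₀ hk0]
      rw [← one_div, le_div_iff₀ h0] at h1
      linarith
  refine ⟨c₁ * K⁻¹ ^ 2, c₂ * k⁻¹ ^ 2, by positivity, by positivity, fun n => ?_⟩
  obtain ⟨h1, h2⟩ := hmul n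
  have hn : (0 : ℝ) < (n : ℝ) + 1 := by positivity
  constructor
  · calc c₁ * K⁻¹ ^ 2 ≤ c₁ * (((n : ℝ) + 1) * L n) ^ 2 := by gcongr
      _ = ((n : ℝ) + 1) ^ 2 * (c₁ * L n ^ 2) := by ring
      _ ≤ _ := by gcongr; exact h₁ n
  · calc ((n : ℝ) + 1) ^ 2 * (L n - L (n + 1)) ≤ ((n : ℝ) + 1) ^ 2 * (c₂ * L n ^ 2) := by
          gcongr; exact h₂ n
      _ = c₂ * (((n : ℝ) + 1) * L n) ^ 2 := by ring
      _ ≤ _ := by have := hL n; gcongr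

theorem orbit_succ_one {p : ℕ → ℝ} (b : ℝ) (n : ℕ) :
    orbit p b (n + 1) 1 = p 0 + p 1 * orbit p b n 1 + R p (orbit p b n 2) := by
  simp [orbit]

theorem orbit_succ_two {p : ℕ → ℝ} (b : ℝ) (n : ℕ) :
    orbit p b (n + 1) 2 = p 0 + p 1 * orbit p b n 1 + b * R p (orbit p b n 2) := by
  simp [orbit]

namespace IsOffspring

variable {p : ℕ → ℝ} (hp : IsOffspring p)
include hp

section Critical

variable {b u v : ℝ} (hb : 1 < b) (hv1 : 1 < v) (huv : u ≤ v) (h : IsCriticalPoint p b u v)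
include hb hv1 huv h

/-- As b > 1, the second component of F reacts more strongly to v than the first. The last
inequality makes L_n in `increment_bounds` comparable to v - v_n alone. -/
theorem orbit_le_critical (n : ℕ) : orbit p b n 1 ≤ u ∧ orbit p b n 2 ≤ v ∧
    u - orbit p b n 1 ≤ v - orbit p b n 2 := by
  obtain ⟨hu1, -, hu, hv, -⟩ := h
  have hle := hp.orbit_le hb.le hu1 hv1.le hu.ge hv.ge n
  refine ⟨hle.1, hle.2, ?_⟩
  cases n with
  | zero => simpa [orbit] using huv
  | succ n =>
    have hle := (hp.orbit_le hb.le hu1 hv1.le hu.ge hv.ge n).2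
    have h1 := hp.R_mono (zero_le_one.trans (hp.one_le_orbit hb.le n 2)) hle
    have h2 := mul_le_mul_of_nonneg_right hb.le (sub_nonneg.2 h1)
    rw [orbit_succ_one, orbit_succ_two]
    linarith

/-- The left eigenvector of the derivative at the critical fixed point, applied to the increments of
the orbit, yields a sequence of order `n⁻²`. -/
theorem increment_bounds : ∃ A B : ℝ, 0 < A ∧ 0 < B ∧ ∀ n : ℕ,
    A ≤ ((n : ℝ) + 1) ^ 2 * (p 1 * (orbit p b (n + 1) 1 - orbit p b n 1) +
      (1 - p 1) * (orbit p b (n + 1) 2 - orbit p b n 2)) ∧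
    ((n : ℝ) + 1) ^ 2 * (p 1 * (orbit p b (n + 1) 1 - orbit p b n 1) +
      (1 - p 1) * (orbit p b (n + 1) 2 - orbit p b n 2)) ≤ B := by
  have hp1 := hp.nonneg 1
  have h1p := hp.one_sub_pos
  have horb := hp.orbit_le_critical hb hv1 huv h
  have hge := fun n => hp.one_le_orbit hb.le n 2
  obtain ⟨hu1, -, hu, hv, hcrit⟩ := h
  rw [(hp.hasDerivAt_R v).deriv] at hcrit
  have hcrit' : 1 - p 1 = ((1 - p 1) * b + p 1) * R' p v := by
    field_simp at hcrit
    linarith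
  set κ := (1 - p 1) * b + p 1 with hκ
  have hκ0 : 0 < κ := by positivity
  set L : ℕ → ℝ := fun n => p 1 * (u - orbit p b n 1) + (1 - p 1) * (v - orbit p b n 2) with hL
  have hLf : ∀ n, (1 - p 1) * (v - orbit p b n 2) ≤ L n ∧ L n ≤ v - orbit p b n 2 := by
    intro n
    obtain ⟨h1, h2, h3⟩ := horb n
    have h4 := mul_nonneg hp1 (sub_nonneg.2 h1)
    have h5 := mul_le_mul_of_nonneg_left h3 hp1
    constructor <;> simp only [hL] <;> linarith
  -- The linear terms cancel because (p₁, 1 - p₁) is a left eigenvector for the eigenvalue 1, which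
  -- is `hcrit'`; only the gap between R and its tangent at v remains.
  have hdec : ∀ n, L n - L (n + 1) = κ * (R' p v * (v - orbit p b n 2) -
      (R p v - R p (orbit p b n 2))) := by
    intro n
    simp only [hL]
    rw [orbit_succ_one, orbit_succ_two]
    linear_combination (-p 1) * hu - (1 - p 1) * hv + (v - orbit p b n 2) * hcrit'
  have hR1 := hp.R'_one_pos
  have hR2 := hp.R''_one_pos
  have hR2v : 0 < R'' p v := hR2.trans_le (hp.R''_mono zero_le_one hv1.le)
  set δ := (1 - p 1) * (b * R' p 1) with hδ
  have hδ0 : 0 < δ := by positivity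
  -- This ratio bound also gives the positivity of L by induction.
  have h3 : ∀ n, δ * L n ≤ L (n + 1) := by
    intro n
    obtain ⟨h1, h2, h3⟩ := horb n
    have h4 : R' p 1 * (v - orbit p b n 2) ≤ R p v - R p (orbit p b n 2) :=
      (mul_le_mul_of_nonneg_right (hp.R'_mono zero_le_one (hge n)) (sub_nonneg.2 h2)).trans
        (hp.R_slope_bounds (zero_le_one.trans (hge n)) h2).1
    have h5 := mul_nonneg hp1 (sub_nonneg.2 h1)
    have h6 : b * (R' p 1 * (v - orbit p b n 2)) ≤ v - orbit p b (n + 1) 2 := by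
      have := mul_le_mul_of_nonneg_left h4 (zero_lt_one.trans hb).le
      rw [orbit_succ_two]
      linarith
    calc δ * L n ≤ δ * (v - orbit p b n 2) := mul_le_mul_of_nonneg_left (hLf n).2 hδ0.le
      _ = (1 - p 1) * (b * (R' p 1 * (v - orbit p b n 2))) := by rw [hδ]; ring
      _ ≤ (1 - p 1) * (v - orbit p b (n + 1) 2) := mul_le_mul_of_nonneg_left h6 h1p.le
      _ ≤ _ := (hLf (n + 1)).1
  have hLpos : ∀ n, 0 < L n := by
    intro n
    induction n with
    | zero =>
      refine lt_of_lt_of_le ?_ (hLf 0).1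
      simpa [orbit] using mul_pos h1p (sub_pos.2 hv1)
    | succ n ih => exact (mul_pos hδ0 ih).trans_le (h3 n)
  have hq := fun n => hp.R_tangent_bounds (zero_le_one.trans (hge n)) (horb n).2.1
  obtain ⟨A, B, hA, hB, hAB⟩ := decrement_bounds (c₁ := κ * (R'' p 1 / 2))
    (c₂ := κ * (R'' p v / 2 * (1 / (1 - p 1)) ^ 2)) hLpos (by positivity) (by positivity) hδ0
    (fun n => by
      rw [hdec, mul_assoc]
      refine mul_le_mul_of_nonneg_left (le_trans ?_ (hq n).1) hκ0.le
      have h1 := hp.R''_mono zero_le_one (hge n)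
      have h2 := (hLpos n).le
      have h3 := (hLf n).2
      have h4 := hR2.trans_le h1
      gcongr)
    (fun n => by
      rw [hdec, mul_assoc]
      refine mul_le_mul_of_nonneg_left ((hq n).2.trans ?_) hκ0.le
      have h2 : v - orbit p b n 2 ≤ 1 / (1 - p 1) * L n := by
        rw [one_div, ← div_eq_inv_mul, le_div_iff₀ h1p, mul_comm]
        exact (hLf n).1
      have h3 := sub_nonneg.2 (horb n).2.1
      rw [mul_assoc, ← mul_pow]
      gcongr) h3
  have e : ∀ n, L n - L (n + 1) = p 1 * (orbit p b (n + 1) 1 - orbit p b n 1) +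
      (1 - p 1) * (orbit p b (n + 1) 2 - orbit p b n 2) := fun n => by simp only [hL]; ring
  simp only [e] at hAB
  exact ⟨A, B, hA, hB, hAB⟩

end Critical

/-! ### Comparison of moments with increments of the orbit -/

section Comparison

variable {b : ℝ} (hb : 1 < b)
include hb

theorem increment_le (n : ℕ) :
    orbit p b (n + 1) 1 - orbit p b n 1 ≤ orbit p b (n + 1) 2 - orbit p b n 2 := by
  cases n with
  | zero =>
    have := mul_le_mul_of_nonneg_right hb.le hp.R_one_pos.le
    simp [orbit]
    linarith
  | succ n =>
    have h1 := hp.R_mono (zero_le_one.trans (hp.one_le_orbit hb.le n 2))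
      (hp.orbit_le_succ hb.le n 2)
    have h2 := mul_le_mul_of_nonneg_right hb.le (sub_nonneg.2 h1)
    linarith [orbit_succ_one (p := p) b (n + 1), orbit_succ_one (p := p) b n,
      orbit_succ_two (p := p) b (n + 1), orbit_succ_two (p := p) b n]

/-- Convexity bounds for the increments of the orbit. -/
theorem increment_succ_bounds (n : ℕ) {x : ℕ} (hx : x = 1 ∨ x = 2) :
    p 1 * (orbit p b (n + 1) 1 - orbit p b n 1) + (if 2 ≤ x then b else 1) *
        (R' p (orbit p b n 2) * (orbit p b (n + 1) 2 - orbit p b n 2)) ≤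
      orbit p b (n + 2) x - orbit p b (n + 1) x ∧
    orbit p b (n + 2) x - orbit p b (n + 1) x ≤
      p 1 * (orbit p b (n + 1) 1 - orbit p b n 1) + (if 2 ≤ x then b else 1) *
        (R' p (orbit p b (n + 1) 2) * (orbit p b (n + 1) 2 - orbit p b n 2)) := by
  obtain ⟨h1, h2⟩ := hp.R_slope_bounds (zero_le_one.trans (hp.one_le_orbit hb.le n 2))
    (hp.orbit_le_succ hb.le n 2)
  have hb0 : 0 ≤ b := (zero_lt_one.trans hb).le
  have h3 := mul_le_mul_of_nonneg_left h1 hb0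
  have h4 := mul_le_mul_of_nonneg_left h2 hb0
  rcases hx with rfl | rfl
  · norm_num
    constructor <;> linarith [orbit_succ_one (p := p) b (n + 1), orbit_succ_one (p := p) b n]
  · norm_num
    constructor <;> linarith [orbit_succ_two (p := p) b (n + 1), orbit_succ_two (p := p) b n]

theorem R'_orbit_pos (n : ℕ) : 0 < R' p (orbit p b n 2) :=
  hp.R'_one_pos.trans_le (hp.R'_mono zero_le_one (hp.one_le_orbit hb.le n 2))

theorem moment_pos (n x : ℕ) : 0 < moment p b n x := by
  induction n generalizing x with
  | zero => simp [moment]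
  | succ n ih =>
    have h1 := mul_nonneg (hp.nonneg 1) (ih 1).le
    have h2 := mul_pos (hp.R'_orbit_pos hb n) (ih 2)
    have h3 : 0 < (if 2 ≤ x then b else 1) := by split_ifs <;> linarith
    rw [moment]
    exact add_pos_of_nonneg_of_pos h1 (mul_pos h3 h2)

theorem increment_two_pos (n : ℕ) : 0 < orbit p b (n + 1) 2 - orbit p b n 2 := by
  induction n with
  | zero =>
    have := mul_lt_mul_of_pos_right hb hp.R_one_pos
    simp [orbit]
    linarith [hp.total]
  | succ n ih =>
    have h1 := mul_nonneg (hp.nonneg 1) (sub_nonneg.2 (hp.orbit_le_succ hb.le n 1))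
    have h2 := mul_pos (zero_lt_one.trans hb) (mul_pos (hp.R'_orbit_pos hb n) ih)
    have h3 := (hp.increment_succ_bounds hb n (Or.inr rfl : 2 = 1 ∨ 2 = 2)).1
    norm_num at h3
    linarith

/-- One step of the recursion carries the second component of an increment into both components.
Positivity in component 1 is available only after such a step, since its first increment vanishes.
-/
theorem mul_increment_two_le (n : ℕ) {x : ℕ} (hx : x = 1 ∨ x = 2) :
    R' p 1 * (orbit p b (n + 1) 2 - orbit p b n 2) ≤ orbit p b (n + 2) x - orbit p b (n + 1) x := by
  refine le_trans ?_ (hp.increment_succ_bounds hb n hx).1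
  have h1 := mul_nonneg (hp.nonneg 1) (sub_nonneg.2 (hp.orbit_le_succ hb.le n 1))
  have h2 := mul_le_mul_of_nonneg_right (hp.R'_mono zero_le_one (hp.one_le_orbit hb.le n 2))
    (hp.increment_two_pos hb n).le
  have h3 : 1 * (R' p (orbit p b n 2) * (orbit p b (n + 1) 2 - orbit p b n 2)) ≤
      (if 2 ≤ x then b else 1) *
        (R' p (orbit p b n 2) * (orbit p b (n + 1) 2 - orbit p b n 2)) :=
    mul_le_mul_of_nonneg_right (by split_ifs <;> linarith)
      (mul_pos (hp.R'_orbit_pos hb n) (hp.increment_two_pos hb n)).le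
  linarith

/-- The moments are bounded by the increments of the orbit. -/
theorem exists_moment_le : ∃ C : ℝ, 0 < C ∧ ∀ n x : ℕ, x = 1 ∨ x = 2 →
    moment p b (n + 1) x ≤ C * (orbit p b (n + 2) x - orbit p b (n + 1) x) := by
  have hd : ∀ {x : ℕ}, x = 1 ∨ x = 2 → 0 < orbit p b 2 x - orbit p b 1 x := fun hx =>
    (mul_pos hp.R'_one_pos (hp.increment_two_pos hb 0)).trans_le (hp.mul_increment_two_le hb 0 hx)
  have hd1 := hd (Or.inl rfl)
  have hd2 := hd (Or.inr rfl)
  have hm1 := hp.moment_pos hb 1 1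
  have hm2 := hp.moment_pos hb 1 2
  -- The comparison starts at the second increment, the first one being zero in component 1; the sum
  -- of the two ratios dominates each of them.
  refine ⟨moment p b 1 1 / (orbit p b 2 1 - orbit p b 1 1) +
    moment p b 1 2 / (orbit p b 2 2 - orbit p b 1 2), by positivity, fun n => ?_⟩
  set C := moment p b 1 1 / (orbit p b 2 1 - orbit p b 1 1) +
    moment p b 1 2 / (orbit p b 2 2 - orbit p b 1 2)
  have hC : 0 ≤ C := by positivity
  induction n with
  | zero =>
    rintro x (rfl | rfl)
    · rw [← div_le_iff₀ hd1]
      exact le_add_of_nonneg_right (by positivity)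
    · rw [← div_le_iff₀ hd2]
      exact le_add_of_nonneg_left (by positivity)
  | succ n ih =>
    intro x hx
    have h1 := mul_le_mul_of_nonneg_left (hp.increment_succ_bounds hb (n + 1) hx).1 hC
    have h2 := mul_le_mul_of_nonneg_left (ih 1 (Or.inl rfl)) (hp.nonneg 1)
    have h3 := mul_le_mul_of_nonneg_left (ih 2 (Or.inr rfl)) (hp.R'_orbit_pos hb (n + 1)).le
    have h4 := mul_le_mul_of_nonneg_left h3 (a := if 2 ≤ x then b else 1)
      (by split_ifs <;> linarith)
    rw [moment]
    linarith

/-- The increments of the orbit are bounded by the moments. -/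
theorem exists_increment_le : ∃ C : ℝ, 0 < C ∧ ∀ n x : ℕ, x = 1 ∨ x = 2 →
    orbit p b (n + 1) x - orbit p b n x ≤ C * moment p b (n + 1) x := by
  have hm1 := hp.moment_pos hb 1 1
  have hm2 := hp.moment_pos hb 1 2
  have hd2 := hp.increment_two_pos hb 0
  -- Only component 2 constrains the constant: in component 1 the initial increment is 0 by `total`.
  refine ⟨(orbit p b 1 2 - orbit p b 0 2) / moment p b 1 2, by positivity, fun n => ?_⟩
  set C := (orbit p b 1 2 - orbit p b 0 2) / moment p b 1 2
  have hC : 0 ≤ C := by positivity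
  induction n with
  | zero =>
    rintro x (rfl | rfl)
    · have : orbit p b 1 1 - orbit p b 0 1 = 0 := by
        simp [orbit]
        linarith [hp.total]
      rw [zero_add, this]
      positivity
    · exact (div_mul_cancel₀ _ hm2.ne').ge
  | succ n ih =>
    intro x hx
    have h1 := (hp.increment_succ_bounds hb n hx).2
    have h2 := mul_le_mul_of_nonneg_left (ih 1 (Or.inl rfl)) (hp.nonneg 1)
    have h3 := mul_le_mul_of_nonneg_left (ih 2 (Or.inr rfl)) (hp.R'_orbit_pos hb (n + 1)).le
    have h4 := mul_le_mul_of_nonneg_left h3 (a := if 2 ≤ x then b else 1)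
      (by split_ifs <;> linarith)
    rw [moment]
    linarith

end Comparison

/-- At the critical value the moments are of order `n⁻²`. -/
theorem moment_bounds {b u v : ℝ} (hb : 1 < b) (hv1 : 1 < v) (huv : u ≤ v)
    (h : IsCriticalPoint p b u v) : ∃ A B : ℝ, 0 < A ∧ 0 < B ∧ ∀ n x : ℕ, 1 ≤ n → x = 1 ∨ x = 2 →
      A ≤ (n : ℝ) ^ 2 * moment p b (n + 1) x ∧ (n : ℝ) ^ 2 * moment p b (n + 1) x ≤ B := by
  obtain ⟨A, B, hA, hB, hAB⟩ := hp.increment_bounds hb hv1 huv h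
  obtain ⟨C, hC, hmC⟩ := hp.exists_moment_le hb
  obtain ⟨D, hD, hmD⟩ := hp.exists_increment_le hb
  have hp1 := hp.nonneg 1
  have h1p := hp.one_sub_pos
  have hR := hp.R'_one_pos
  refine ⟨R' p 1 * A / D, C * B / (1 - p 1), by positivity, by positivity, fun n x hn hx => ?_⟩
  constructor
  -- The increment at m = n - 1 is pushed forward once to reach component x, then compared with the
  -- moment of index m + 2 = n + 1.
  · obtain ⟨m, rfl⟩ : ∃ m, n = m + 1 := ⟨n - 1, by omega⟩
    have h1 := (hAB m).1
    have h2 := mul_le_mul_of_nonneg_left (hp.increment_le hb m) hp1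
    have h3 : A ≤ ((m : ℝ) + 1) ^ 2 * (orbit p b (m + 1) 2 - orbit p b m 2) :=
      h1.trans (mul_le_mul_of_nonneg_left (by linarith) (sq_nonneg _))
    have h4 := (hp.mul_increment_two_le hb m hx).trans (hmD (m + 1) x hx)
    rw [div_le_iff₀ hD]
    push_cast
    calc R' p 1 * A ≤ R' p 1 * (((m : ℝ) + 1) ^ 2 * (orbit p b (m + 1) 2 - orbit p b m 2)) := by
          gcongr
      _ = ((m : ℝ) + 1) ^ 2 * (R' p 1 * (orbit p b (m + 1) 2 - orbit p b m 2)) := by ring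
      _ ≤ ((m : ℝ) + 1) ^ 2 * (D * moment p b (m + 1 + 1) x) := by gcongr
      _ = _ := by ring
  · have h1 := (hAB (n + 1)).2
    push_cast at h1
    have h2 : orbit p b (n + 2) x - orbit p b (n + 1) x ≤
        orbit p b (n + 2) 2 - orbit p b (n + 1) 2 := by
      rcases hx with rfl | rfl
      · exact hp.increment_le hb (n + 1)
      · exact le_rfl
    have h3 := mul_nonneg hp1 (sub_nonneg.2 (hp.orbit_le_succ hb.le (n + 1) 1))
    have h4 := (hp.increment_two_pos hb (n + 1)).le
    have h5 : (n : ℝ) ^ 2 * ((1 - p 1) * (orbit p b (n + 2) 2 - orbit p b (n + 1) 2)) ≤ B := by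
      refine le_trans ?_ h1
      have h6 : (n : ℝ) ≤ (n : ℝ) + 1 + 1 := by linarith
      have h7 := mul_nonneg h1p.le h4
      gcongr
      exact le_add_of_nonneg_left h3
    rw [le_div_iff₀ h1p]
    calc (n : ℝ) ^ 2 * moment p b (n + 1) x * (1 - p 1)
        ≤ (n : ℝ) ^ 2 * (C * (orbit p b (n + 2) 2 - orbit p b (n + 1) 2)) * (1 - p 1) := by
          gcongr
          exact (hmC n x hx).trans (mul_le_mul_of_nonneg_left h2 hC.le)
      _ = C * ((n : ℝ) ^ 2 * ((1 - p 1) * (orbit p b (n + 2) 2 - orbit p b (n + 1) 2))) := by ring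
      _ ≤ C * B := by gcongr

end IsOffspring

end InteractingBGW

theorem corollary1 (p : ℕ → ℝ)
    (hp_nonneg : ∀ k, 0 ≤ p k) (hp_sum : HasSum p 1)
    (hp_branch : p 0 + p 1 < 1)
    (hp_entire : ∀ v : ℝ, Summable fun k : ℕ => p k * v ^ k)
    (hp_subcritical : ∑' k : ℕ, (k : ℝ) * p k < 1) :
    ∃ b_c : ℝ, InteractingBGW.IsCriticalValue p b_c ∧
      ∀ x : ℕ, x = 1 ∨ x = 2 →
        ∃ C : ℝ, 1 < C ∧ ∀ n : ℕ, 1 ≤ n →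
          (Summable fun ω : InteractingBGW.PlaneTree n =>
            InteractingBGW.gibbsProb p (Real.log b_c) x n ω *
              (InteractingBGW.externalNodes ω : ℝ)) ∧
          C⁻¹ < (n : ℝ) ^ 2 * InteractingBGW.expectation p (Real.log b_c) x n
            (fun ω => (InteractingBGW.externalNodes ω : ℝ)) ∧
          (n : ℝ) ^ 2 * InteractingBGW.expectation p (Real.log b_c) x n
            (fun ω => (InteractingBGW.externalNodes ω : ℝ)) < C := by
  have hp : InteractingBGW.IsOffspring p :=
    ⟨hp_nonneg, hp_sum, hp_branch, hp_entire, hp_subcritical⟩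
  obtain ⟨b, u, v, hbc, hcrit, hv1, huv⟩ := hp.exists_isCriticalValue
  refine ⟨b, hbc, fun x hx => ?_⟩
  have hb : 1 < b := hbc.1
  obtain ⟨A, B, hA, hB, hAB⟩ := hp.moment_bounds hb hv1 huv hcrit
  have hv0 : 0 < v := zero_lt_one.trans hv1
  -- The partition function lies in [1, v], so the quantity lies in [A / v, B]; the summand 1 makes
  -- the inequalities strict.
  refine ⟨v / A + B + 1, by linarith [div_pos hv0 hA], fun n hn => ?_⟩
  have hs := hp.hasSum_gibbsProb_mul_externalNodes (zero_lt_one.trans hb) n x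
  refine ⟨hs.summable, ?_⟩
  rw [InteractingBGW.expectation, hs.tsum_eq]
  obtain ⟨h1, h2⟩ := hAB n x hn hx
  have h3 := hp.one_le_orbit hb.le (n + 1) x
  have h4 : InteractingBGW.orbit p b (n + 1) x ≤ v := by
    obtain ⟨hu', hv', -⟩ := hp.orbit_le_critical hb hv1 huv hcrit (n + 1)
    rcases hx with rfl | rfl
    · exact hu'.trans huv
    · exact hv'
  have h5 : 0 < InteractingBGW.orbit p b (n + 1) x := zero_lt_one.trans_le h3
  have e : (n : ℝ) ^ 2 * ((InteractingBGW.orbit p b (n + 1) x)⁻¹ *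
      InteractingBGW.moment p b (n + 1) x) =
      (n : ℝ) ^ 2 * InteractingBGW.moment p b (n + 1) x / InteractingBGW.orbit p b (n + 1) x := by
    rw [div_eq_mul_inv]
    ring
  rw [e]
  have hlow : A / v ≤
      (n : ℝ) ^ 2 * InteractingBGW.moment p b (n + 1) x / InteractingBGW.orbit p b (n + 1) x :=
    div_le_div₀ (hA.le.trans h1) h1 h5 h4
  have hup : (n : ℝ) ^ 2 * InteractingBGW.moment p b (n + 1) x /
      InteractingBGW.orbit p b (n + 1) x ≤ B := by
    rw [div_le_iff₀ h5]
    nlinarith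
  constructor
  · refine lt_of_lt_of_le ?_ hlow
    rw [← inv_div v A]
    exact inv_strictAnti₀ (div_pos hv0 hA) (by linarith)
  · linarith [div_pos hv0 hA]
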